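/- Let $p\in\mathbb N$, and let $\mathcal A_n=\mathcal A_n^*\in\mathbb C^{p\times p}$ and invertible $\mathcal B_n\in\mathbb C^{p\times p}$, $n\in\mathbb N_0$, be given. Put $\mathcal B_{-1}:=0$. Let $\mathbf J$ be the minimal block Jacobi operator in $l^2(\mathbb N_0;\mathbb C^p)$, i.e. the closure of the symmetric operator defined on the finite sequences $f=(f_n)_{n\ge 0}$ by $$(\mathbf J f)_n=\mathcal B_{n-1}^*f_{n-1}+\mathcal A_nf_n+\mathcal B_nf_{n+1},\qquad n\in\mathbb N_0,$$ where the first term is absent for $n=0$. Let $\mathcal A=\operatorname{diag}\{\mathcal A_0,\mathcal A_1,\ldots\}$ be the block diagonal operator with its natural domain $\operatorname{dom}\mathcal A=\{f\in l^2(\mathbb N_0;\mathbb C^p):(\mathcal A_nf_n)_{n\ge0}\in l^2(\mathbb N_0;\mathbb C^p)\}$, and suppose that $\ker\mathcal A=\{0\}$ (equivalently, every $\mathcal A_n$ is invertible). Let $\|\cdot\|$ be the operator norm of matrices on the Euclidean space $\mathbb C^p$, and suppose that for some $N\in\mathbb N_0$ $$a_1(N):=\sup_{n\ge N}\Big(\|\mathcal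 A_n^{-1}\mathcal B_n\|+\|\mathcal A_n^{-1}\mathcal B_{n-1}^*\|\Big)<\infty,\qquad a_2(N):=\sup_{n\ge N}\Big(\|\mathcal A_n^{-1}\mathcal B_n\|+\|\mathcal A_{n+2}^{-1}\mathcal B_{n+1}^*\|\Big)<\infty .$$ If $a_1(N)a_2(N)\le 1$, then $\mathbf J$ is essentially selfadjoint on $\operatorname{dom}\mathcal A$, i.e. $\operatorname{dom}\mathcal A\subseteq\operatorname{dom}\mathbf J$ and the closure of the restriction $\mathbf J|_{\operatorname{dom}\mathcal A}$ is selfadjoint. If $a_1(N)a_2(N)<1$, then $\mathbf J$ is selfadjoint and $\operatorname{dom}\mathbf J=\operatorname{dom}\mathcal A$. -/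

import Mathlib

open scoped ENNReal InnerProductSpace

noncomputable section

/-- The Hilbert space `l²(ℕ₀; ℂᵖ)`, where `ℂᵖ` carries its Euclidean inner product. -/
abbrev BlockSeq (p : ℕ) : Type := lp (fun _ : ℕ => EuclideanSpace ℂ (Fin p)) 2

/-- The operator on the Euclidean space `ℂᵖ` given by a `p × p` matrix. Its norm is the operator
(spectral) norm of the matrix. -/
abbrev matOp {p : ℕ} (M : Matrix (Fin p) (Fin p) ℂ) :
    EuclideanSpace ℂ (Fin p) →L[ℂ] EuclideanSpace ℂ (Fin p) :=
  Matrix.toEuclideanCLM (𝕜 := ℂ) M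

/-- The operator norm of a matrix on the Euclidean space `ℂᵖ`, as an extended nonnegative real. -/
def matNorm {p : ℕ} (M : Matrix (Fin p) (Fin p) ℂ) : ℝ≥0∞ := ENNReal.ofReal ‖matOp M‖

/-- The entries of an infinite block Jacobi matrix with `p × p` blocks: selfadjoint blocks `A n` on
the diagonal, invertible blocks `B n` above it, and their adjoints `(B n)ᴴ` below it. -/
structure BlockJacobi (p : ℕ) where
  A : ℕ → Matrix (Fin p) (Fin p) ℂ
  B : ℕ → Matrix (Fin p) (Fin p) ℂ
  isHermitian_A : ∀ n, (A n).IsHermitian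
  isUnit_B : ∀ n, IsUnit (B n)

/-- The finite sequences in `l²(ℕ₀; ℂᵖ)`. -/
def finiteSeq (p : ℕ) : Submodule ℂ (BlockSeq p) where
  carrier := {f | {n | f n ≠ 0}.Finite}
  zero_mem' := by simp
  add_mem' := by
    intro f g hf hg
    refine (hf.union hg).subset ?_
    intro n hn
    by_contra h
    simp only [Set.mem_union, Set.mem_ofPred_eq, not_or, not_not] at h
    exact hn (by simp [h.1, h.2])
  smul_mem' := by
    intro c f hf
    refine hf.subset ?_
    intro n hn h
    exact hn (by simp [h])

namespace BlockJacobi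

variable {p : ℕ} (J : BlockJacobi p)

/-- The block of row `n` directly to the left of the diagonal, that is `(B (n - 1))ᴴ`;
there is none in row `0`, so it is zero there. -/
def lower : ℕ → Matrix (Fin p) (Fin p) ℂ
  | 0 => 0
  | n + 1 => (J.B n).conjTranspose

/-- The formal product of the block Jacobi matrix with an arbitrary sequence of vectors:
`(J f) n = (B (n - 1))ᴴ (f (n - 1)) + A n (f n) + B n (f (n + 1))`. -/
def formal : (ℕ → EuclideanSpace ℂ (Fin p)) →ₗ[ℂ] (ℕ → EuclideanSpace ℂ (Fin p)) where
  toFun f n := matOp (J.lower n) (f (n - 1)) + matOp (J.A n) (f n) + matOp (J.B n) (f (n + 1))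
  map_add' f g := by
    funext n
    simp only [Pi.add_apply, map_add]
    abel
  map_smul' c f := by
    funext n
    simp only [Pi.smul_apply, map_smul, smul_add, RingHom.id_apply]

theorem formal_memℓp {f : BlockSeq p} (hf : f ∈ finiteSeq p) : Memℓp (J.formal f) 2 := by
  refine (memℓp_zero ?_).of_exponent_ge zero_le
  have hf' : {n | f n ≠ 0}.Finite := hf
  refine ((hf'.union (hf'.image (· + 1))).union (hf'.image (· - 1))).subset ?_
  intro n hn
  by_contra h
  simp only [Set.mem_union, Set.mem_image, Set.mem_ofPred_eq, not_or, not_exists, not_and,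
    not_not] at h
  obtain ⟨⟨h1, h2⟩, h3⟩ := h
  apply hn
  have e3 : f (n + 1) = 0 := by
    by_contra h'
    exact h3 (n + 1) h' (by simp)
  have e2 : matOp (J.lower n) (f (n - 1)) = 0 := by
    cases n with
    | zero => simp [lower]
    | succ m =>
      have : f m = 0 := by
        by_contra h'
        exact h2 m h' rfl
      simp [this]
  simp [formal, h1, e2, e3]

/-- The operator `f ↦ J f` on finite sequences. -/
def preOp : BlockSeq p →ₗ.[ℂ] BlockSeq p where
  domain := finiteSeq p
  toFun :=
    { toFun := fun f => ⟨J.formal (f : BlockSeq p), J.formal_memℓp f.2⟩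
      map_add' := fun f g => Subtype.ext (J.formal.map_add (f : BlockSeq p) (g : BlockSeq p))
      map_smul' := fun c f => Subtype.ext (J.formal.map_smul c (f : BlockSeq p)) }

/-- The (minimal) Jacobi operator: the closure of the operator on finite sequences, which is
symmetric and densely defined, hence closable. -/
def op : BlockSeq p →ₗ.[ℂ] BlockSeq p := J.preOp.closure

/-- The block diagonal operator `diag (A 0, A 1, …)` in `l²(ℕ₀; ℂᵖ)` on its natural domain, the set
of all `f` in `l²` for which the sequence `A n (f n)` is in `l²`. -/
def diagOp : BlockSeq p →ₗ.[ℂ] BlockSeq p where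
  domain :=
    { carrier := {f | Memℓp (fun n => matOp (J.A n) (f n)) 2}
      zero_mem' := by
        have e : (fun n => matOp (J.A n) ((0 : BlockSeq p) n)) = 0 := by
          funext n
          simp
        simpa only [Set.mem_ofPred_eq, e] using
          (zero_memℓp : Memℓp (0 : ℕ → EuclideanSpace ℂ (Fin p)) 2)
      add_mem' := by
        intro f g hf hg
        have h := Memℓp.add hf hg
        have e : (fun n => matOp (J.A n) ((f + g) n))
            = (fun n => matOp (J.A n) (f n)) + fun n => matOp (J.A n) (g n) := by
          funext n
          simp
        simpa only [Set.mem_ofPred_eq, e] using h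
      smul_mem' := by
        intro c f hf
        have h := Memℓp.const_smul hf c
        have e : (fun n => matOp (J.A n) ((c • f) n)) = c • fun n => matOp (J.A n) (f n) := by
          funext n
          simp
        simpa only [Set.mem_ofPred_eq, e] using h }
  toFun :=
    { toFun := fun f => ⟨fun n => matOp (J.A n) ((f : BlockSeq p) n), f.2⟩
      map_add' := by
        intro f g
        ext1
        funext n
        exact map_add (matOp (J.A n)) _ _
      map_smul' := by
        intro c f
        ext1
        funext n
        exact map_smul (matOp (J.A n)) _ _ }

/-- `a₁(N) = sup_{n ≥ N} (‖Aₙ⁻¹ Bₙ‖ + ‖Aₙ⁻¹ Bₙ₋₁*‖)`, possibly infinite, with `B₋₁ = 0`. -/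
def a₁ (N : ℕ) : ℝ≥0∞ :=
  ⨆ n ≥ N, (matNorm ((J.A n)⁻¹ * J.B n) + matNorm ((J.A n)⁻¹ * J.lower n))

/-- `a₂(N) = sup_{n ≥ N} (‖Aₙ⁻¹ Bₙ‖ + ‖Aₙ₊₂⁻¹ Bₙ₊₁*‖)`, possibly infinite. -/
def a₂ (N : ℕ) : ℝ≥0∞ :=
  ⨆ n ≥ N, (matNorm ((J.A n)⁻¹ * J.B n) +
    matNorm ((J.A (n + 2))⁻¹ * (J.B (n + 1)).conjTranspose))

end BlockJacobi

/-- The operator `T` is essentially selfadjoint on the subspace `D` of its domain: the closure of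
the restriction of `T` to `D` is selfadjoint. -/
def EssentiallySelfAdjointOn {H : Type*} [NormedAddCommGroup H] [InnerProductSpace ℂ H]
    [CompleteSpace H] (T : H →ₗ.[ℂ] H) (D : Submodule ℂ H) : Prop :=
  D ≤ T.domain ∧ (T.domRestrict D).IsClosable ∧ IsSelfAdjoint (T.domRestrict D).closure

end

/-! Cut the off-diagonal blocks at `N`. The finitely many blocks of the head form a bounded
symmetric operator, which affects neither cores nor domains. On the domain of the diagonal `A` the
tail factors as `M A`, where `M` has entries of the form `B A⁻¹`. By passing to adjoints, the row
sums of `M` are bounded by `a₂(N)` and its column sums by `a₁(N)`, so the Schur test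
`exists_tridiag_clm` gives `‖M‖ ≤ √(a₁ a₂)`.

For `‖M‖ ≤ 1` the equation `T u = z u`, `z = ±i`, has no nonzero `l²` solution for the maximal
operator `T = (1 + M) A` (`eq_zero_of_tridiag_eq_smul`). Put `g = (A + z)⁻¹ u` and `d = A g`.
Symmetry gives `⟪u, u + M d⟫ = 0`, while `‖M d‖ ≤ ‖d‖ ≤ ‖u‖`; this forces `u + M d = 0`, that is, `T
g = -z g` with `g` in the domain of `A`, where `T` is symmetric. Hence `g = 0` and `u = 0`.
Vanishing deficiency spaces make the minimal and maximal operators equal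
(`maximalGraph_le_closure`), and the adjoint of the minimal operator is the maximal one.

For `‖M‖ < 1` the estimate `‖A f‖ ≤ ‖T f‖ / (1 - ‖M‖)` on finite sequences passes to the closure and
yields equality of domains. -/

section Tridiagonal

/-! ### Tridiagonal operator matrices and the Schur test. -/

open Filter Topology

variable {E : Type*} [NormedAddCommGroup E] [InnerProductSpace ℂ E]

/-- The formal product of the tridiagonal operator matrix with diagonal `A`, lower diagonal `L` and
upper diagonal `R` with a sequence. -/
def tridiag (A L R : ℕ → E →L[ℂ] E) (f : ℕ → E) (n : ℕ) : E :=
  L n (f (n - 1)) + A n (f n) + R n (f (n + 1))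

/-- Interchange of row and column summation: `b` bounds the column sums, and `h1` is column `0`,
which has no entry above the diagonal. -/
theorem sum_range_shift_le {l r F : ℕ → ℝ} {b : ℝ} (hl0 : l 0 = 0) (hl : ∀ n, 0 ≤ l n)
    (hF : ∀ n, 0 ≤ F n) (h1 : l 1 ≤ b) (hb : ∀ n, r n + l (n + 2) ≤ b) (K : ℕ) :
    ∑ n ∈ Finset.range K, (l n * F (n - 1) + r n * F (n + 1)) ≤
      b * ∑ n ∈ Finset.range (K + 1), F n := by
  -- Indexed by column instead of row: `r' m = r (m - 1)`, with nothing in column `0`.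
  let r' : ℕ → ℝ := fun n => n.casesOn 0 r
  have hc : ∀ m, l (m + 1) + r' m ≤ b := by
    rintro (_ | m)
    · simpa [r'] using h1
    · exact (add_comm _ _).trans_le (hb m)
  have hr' : ∀ m, r' m ≤ b := fun m => by linarith [hc m, hl (m + 1)]
  cases K with
  | zero => simpa using mul_nonneg ((hl 1).trans h1) (hF 0)
  | succ K =>
    -- Truncation after row `K` removes the lower entries of columns `K` and `K + 1`, so only their
    -- upper entries remain.
    have key : ∀ K, ∑ n ∈ Finset.range (K + 1), (l n * F (n - 1) + r n * F (n + 1)) =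
        (∑ m ∈ Finset.range K, (l (m + 1) + r' m) * F m) + r' K * F K +
          r' (K + 1) * F (K + 1) := by
      intro K
      induction K with
      | zero => simp [hl0, r']
      | succ K ih =>
        rw [Finset.sum_range_succ, ih, Finset.sum_range_succ]
        simp only [r', Nat.add_sub_cancel]
        ring
    rw [key, Finset.sum_range_succ, Finset.sum_range_succ, mul_add, mul_add, Finset.mul_sum]
    exact add_le_add (add_le_add
      (Finset.sum_le_sum fun m _ => mul_le_mul_of_nonneg_right (hc m) (hF m))
      (mul_le_mul_of_nonneg_right (hr' K) (hF K)))
      (mul_le_mul_of_nonneg_right (hr' (K + 1)) (hF (K + 1)))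

theorem lp_norm_sq_le {E : Type*} [NormedAddCommGroup E] {f : ℕ → E} {C : ℝ} (hC : 0 ≤ C)
    (h : ∀ K, ∑ n ∈ Finset.range K, ‖f n‖ ^ 2 ≤ C ^ 2) :
    ∃ g : lp (fun _ : ℕ => E) 2, (∀ n, g n = f n) ∧ ‖g‖ ≤ C := by
  have h' : ∀ s : Finset ℕ, ∑ n ∈ s, ‖f n‖ ^ (2 : ℝ≥0∞).toReal ≤ C ^ (2 : ℝ≥0∞).toReal := by
    intro s
    simp only [ENNReal.toReal_ofNat, Real.rpow_two]
    obtain ⟨K, hK⟩ := s.exists_nat_subset_range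
    exact (Finset.sum_le_sum_of_subset_of_nonneg hK fun _ _ _ => by positivity).trans (h K)
  exact ⟨⟨f, memℓp_gen' h'⟩, fun _ => rfl, lp.norm_le_of_forall_sum_le (by simp) hC h'⟩

theorem lp_sum_norm_sq_le {E : Type*} [NormedAddCommGroup E] (f : lp (fun _ : ℕ => E) 2) (s : Finset ℕ) :
    ∑ n ∈ s, ‖f n‖ ^ 2 ≤ ‖f‖ ^ 2 := by
  simpa [ENNReal.toReal_ofNat, Real.rpow_two] using
    lp.sum_rpow_le_norm_rpow (p := 2) (by simp) f s

/-- The Schur test for tridiagonal operator matrices with vanishing diagonal. -/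
theorem exists_tridiag_clm {L R : ℕ → E →L[ℂ] E} {a b : ℝ} (hL0 : L 0 = 0)
    (ha : ∀ n, ‖L n‖ + ‖R n‖ ≤ a) (h1 : ‖L 1‖ ≤ b) (hb : ∀ n, ‖R n‖ + ‖L (n + 2)‖ ≤ b) :
    ∃ M : lp (fun _ : ℕ => E) 2 →L[ℂ] lp (fun _ : ℕ => E) 2,
      (∀ f n, M f n = L n (f (n - 1)) + R n (f (n + 1))) ∧ ‖M‖ ≤ √(a * b) := by
  have ha0 : 0 ≤ a := (add_nonneg (norm_nonneg _) (norm_nonneg _)).trans (ha 0)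
  have hb0 : 0 ≤ b := (norm_nonneg _).trans h1
  have key : ∀ f : lp (fun _ : ℕ => E) 2, ∃ g : lp (fun _ : ℕ => E) 2,
      (∀ n, g n = L n (f (n - 1)) + R n (f (n + 1))) ∧ ‖g‖ ≤ √(a * b) * ‖f‖ := by
    intro f
    refine lp_norm_sq_le (by positivity) fun K => ?_
    calc ∑ n ∈ Finset.range K, ‖L n (f (n - 1)) + R n (f (n + 1))‖ ^ 2
        ≤ ∑ n ∈ Finset.range K,
            a * (‖L n‖ * ‖f (n - 1)‖ ^ 2 + ‖R n‖ * ‖f (n + 1)‖ ^ 2) := by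
          refine Finset.sum_le_sum fun n _ => ?_
          have h := (norm_add_le (L n (f (n - 1))) (R n (f (n + 1)))).trans
            (add_le_add ((L n).le_opNorm _) ((R n).le_opNorm _))
          -- Weighted Cauchy–Schwarz; the two sides differ by `‖L n‖ ‖R n‖ (‖f (n - 1)‖ - ‖f (n +
          -- 1)‖)²`.
          have h2 : (‖L n‖ * ‖f (n - 1)‖ + ‖R n‖ * ‖f (n + 1)‖) ^ 2 ≤
              (‖L n‖ + ‖R n‖) * (‖L n‖ * ‖f (n - 1)‖ ^ 2 + ‖R n‖ * ‖f (n + 1)‖ ^ 2) := by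
            have := mul_nonneg (mul_nonneg (norm_nonneg (L n)) (norm_nonneg (R n)))
              (sq_nonneg (‖f (n - 1)‖ - ‖f (n + 1)‖))
            linarith
          exact (pow_le_pow_left₀ (norm_nonneg _) h 2).trans (h2.trans
            (mul_le_mul_of_nonneg_right (ha n) (by positivity)))
      _ ≤ a * (b * ∑ n ∈ Finset.range (K + 1), ‖f n‖ ^ 2) := by
          rw [← Finset.mul_sum]
          exact mul_le_mul_of_nonneg_left (sum_range_shift_le (F := fun n => ‖f n‖ ^ 2)
            (by simp [hL0]) (fun n => norm_nonneg (L n)) (fun n => by positivity) h1 hb K) ha0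
      _ ≤ (√(a * b) * ‖f‖) ^ 2 := by
          rw [mul_pow, Real.sq_sqrt (by positivity), mul_assoc]
          gcongr
          exact lp_sum_norm_sq_le f _
  choose M hM hMn using key
  refine ⟨LinearMap.mkContinuous
    { toFun := M
      map_add' := fun f g => ?_
      map_smul' := fun c f => ?_ } _ hMn, hM, LinearMap.mkContinuous_norm_le _ (by positivity) _⟩
  · ext n
    simp only [lp.coeFn_add, Pi.add_apply, hM, map_add]
    abel_nf
  · ext n
    simp [hM]

/-! ### Minimal and maximal graphs and their formal adjointness. -/

section Core

variable {A L R : ℕ → E →L[ℂ] E}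

/-- The graph of the tridiagonal operator on the finite sequences. -/
def finiteGraph (A L R : ℕ → E →L[ℂ] E) :
    Submodule ℂ (lp (fun _ : ℕ => E) 2 × lp (fun _ : ℕ => E) 2) where
  carrier := {x | {n | x.1 n ≠ 0}.Finite ∧ ∀ n, x.2 n = tridiag A L R x.1 n}
  zero_mem' := by simp [tridiag]
  add_mem' := by
    rintro x y ⟨hx, hx'⟩ ⟨hy, hy'⟩
    refine ⟨(hx.union hy).subset fun n hn => ?_, fun n => ?_⟩
    · by_contra h
      simp only [Set.mem_union, Set.mem_ofPred_eq, not_or, not_not] at h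
      exact hn (by simp [h.1, h.2])
    · simp only [Prod.snd_add, Prod.fst_add, lp.coeFn_add, Pi.add_apply, hx', hy', tridiag, map_add]
      abel
  smul_mem' := by
    rintro c x ⟨hx, hx'⟩
    refine ⟨hx.subset fun n hn h => hn (by simp [h]), fun n => ?_⟩
    simp [hx', tridiag]

/-- The graph of the maximal operator generated by a tridiagonal operator matrix. -/
def maximalGraph (A L R : ℕ → E →L[ℂ] E) :
    Submodule ℂ (lp (fun _ : ℕ => E) 2 × lp (fun _ : ℕ => E) 2) where
  carrier := {x | ∀ n, x.2 n = tridiag A L R x.1 n}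
  zero_mem' := by simp [tridiag]
  add_mem' := by
    intro x y hx hy n
    simp only [Prod.snd_add, Prod.fst_add, lp.coeFn_add, Pi.add_apply, hx n, hy n, tridiag,
      map_add]
    abel
  smul_mem' := by
    intro c x hx n
    simp [hx n, tridiag]

theorem mem_maximalGraph {x : lp (fun _ : ℕ => E) 2 × lp (fun _ : ℕ => E) 2} :
    x ∈ maximalGraph A L R ↔ ∀ n, x.2 n = tridiag A L R x.1 n := Iff.rfl

theorem finiteGraph_le_maximalGraph : finiteGraph A L R ≤ maximalGraph A L R := fun _ hx => hx.2

theorem continuous_lp_apply (n : ℕ) :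
    Continuous fun f : lp (fun _ : ℕ => E) 2 => (f n : E) :=
  (lp.evalCLM ℂ (fun _ : ℕ => E) 2 n).continuous

theorem isClosed_maximalGraph : IsClosed
    (maximalGraph A L R : Set (lp (fun _ : ℕ => E) 2 × lp (fun _ : ℕ => E) 2)) := by
  have : (maximalGraph A L R : Set (lp (fun _ : ℕ => E) 2 × lp (fun _ : ℕ => E) 2)) =
      ⋂ n, {x | x.2 n = tridiag A L R x.1 n} := by
    ext x
    simp [mem_maximalGraph]
  rw [this]
  refine isClosed_iInter fun n => isClosed_eq ((continuous_lp_apply n).comp continuous_snd) ?_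
  have h : ∀ m, Continuous fun x : lp (fun _ : ℕ => E) 2 × lp (fun _ : ℕ => E) 2 => (x.1 m : E) :=
    fun m => (continuous_lp_apply m).comp continuous_fst
  exact (((L n).continuous.comp (h _)).add ((A n).continuous.comp (h _))).add
    ((R n).continuous.comp (h _))

/-- The column with index `m` of a tridiagonal operator matrix. -/
theorem tridiag_single (hL0 : L 0 = 0) (m : ℕ) (x : E) (n : ℕ) :
    tridiag A L R (lp.single 2 m x : lp (fun _ : ℕ => E) 2) n =
      (lp.single 2 (m + 1) (L (m + 1) x) + lp.single 2 m (A m x) +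
        (match m with
          | 0 => 0
          | k + 1 => lp.single 2 k (R k x)) : lp (fun _ : ℕ => E) 2) n := by
  have h : ∀ i (y : E) j, (lp.single 2 i y : lp (fun _ : ℕ => E) 2) j = if j = i then y else 0 := by
    intro i y j
    by_cases hij : j = i
    · subst hij; simp
    · simp [hij]
  cases m with
  | zero =>
    rcases n with _ | n
    · simp [tridiag, hL0]
    · by_cases hn : n = 0
      · subst hn; simp [tridiag]
      · simp [tridiag, hn]
  | succ k =>
    simp only [tridiag, lp.coeFn_add, Pi.add_apply, h]
    congr 1
    · congr 1
      · rcases n with _ | n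
        · simp
        · by_cases hn : n = k + 1
          · subst hn; simp
          · simp [hn]
      · by_cases hn : n = k + 1
        · subst hn; simp
        · simp [hn]
    · by_cases hn : n = k
      · subst hn; simp
      · simp [hn]

theorem single_mem_finiteGraph (m : ℕ) (x : E)
    {w : lp (fun _ : ℕ => E) 2}
    (hw : ∀ n, w n = tridiag A L R (lp.single 2 m x : lp (fun _ : ℕ => E) 2) n) :
    (lp.single 2 m x, w) ∈ finiteGraph A L R := by
  refine ⟨(Set.finite_singleton m).subset fun n hn => ?_, hw⟩
  by_contra h
  exact hn (lp.single_apply_ne (E := fun _ : ℕ => E) 2 m x h)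

/-- Summation by parts against a sequence with one entry. -/
theorem inner_tridiag_single (hL0 : L 0 = 0) (hA : ∀ n x y, ⟪A n x, y⟫_ℂ = ⟪x, A n y⟫_ℂ)
    (hLR : ∀ n x y, ⟪L (n + 1) x, y⟫_ℂ = ⟪x, R n y⟫_ℂ)
    (u : lp (fun _ : ℕ => E) 2) (m : ℕ) (x : E) {w : lp (fun _ : ℕ => E) 2}
    (hw : ∀ n, w n = tridiag A L R (lp.single 2 m x : lp (fun _ : ℕ => E) 2) n) :
    ⟪u, w⟫_ℂ = ⟪tridiag A L R u m, x⟫_ℂ := by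
  have hRL : ∀ n x y, ⟪x, L (n + 1) y⟫_ℂ = ⟪R n x, y⟫_ℂ := fun n x y => by
    rw [← inner_conj_symm, hLR, inner_conj_symm]
  have hw' := lp.ext (funext fun n => (hw n).trans (tridiag_single hL0 m x n))
  subst hw'
  cases m with
  | zero =>
    simp [lp.inner_single_right, tridiag, hL0, hRL, hA]
    abel
  | succ k =>
    simp [lp.inner_single_right, tridiag, hRL, hA, hLR]
    abel

theorem exists_tridiag_single (hL0 : L 0 = 0) (m : ℕ) (x : E) : ∃ w : lp (fun _ : ℕ => E) 2,
    ∀ n, w n = tridiag A L R (lp.single 2 m x : lp (fun _ : ℕ => E) 2) n :=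
  ⟨_, fun n => (tridiag_single hL0 m x n).symm⟩

/-- The maximal operator is a formal adjoint of the operator on finite sequences. -/
theorem inner_eq_of_mem_finiteGraph (hL0 : L 0 = 0) (hA : ∀ n x y, ⟪A n x, y⟫_ℂ = ⟪x, A n y⟫_ℂ)
    (hLR : ∀ n x y, ⟪L (n + 1) x, y⟫_ℂ = ⟪x, R n y⟫_ℂ)
    {x y : lp (fun _ : ℕ => E) 2 × lp (fun _ : ℕ => E) 2} (hx : x ∈ finiteGraph A L R)
    (hy : y ∈ maximalGraph A L R) : ⟪y.1, x.2⟫_ℂ = ⟪y.2, x.1⟫_ℂ := by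
  choose w hw using fun m => exists_tridiag_single (A := A) (R := R) hL0 m (x.1 m)
  have hfin : {n | x.1 n ≠ 0}.Finite := hx.1
  have h1 : x.1 = ∑ m ∈ hfin.toFinset, lp.single 2 m (x.1 m) := by
    refine (lp.hasSum_single (p := 2) (by simp) x.1).unique (hasSum_sum_of_ne_finset_zero ?_)
    intro m hm
    have : x.1 m = 0 := by simpa using hm
    rw [this, lp.single_zero]
  have h2 : (x.1, ∑ m ∈ hfin.toFinset, w m) ∈ maximalGraph A L R := by
    have h : ∑ m ∈ hfin.toFinset, ((lp.single 2 m (x.1 m) : lp (fun _ : ℕ => E) 2), w m) ∈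
        maximalGraph A L R := Submodule.sum_mem _ fun m _ => hw m
    have h' : ∑ m ∈ hfin.toFinset, ((lp.single 2 m (x.1 m) : lp (fun _ : ℕ => E) 2), w m) =
        (x.1, ∑ m ∈ hfin.toFinset, w m) :=
      Prod.ext (by rw [Prod.fst_sum, ← h1]) (by rw [Prod.snd_sum])
    rwa [h'] at h
  have h3 : x.2 = ∑ m ∈ hfin.toFinset, w m :=
    lp.ext (funext fun n => (hx.2 n).trans (h2 n).symm)
  conv_rhs => rw [h1]
  rw [h3, inner_sum, inner_sum]
  refine Finset.sum_congr rfl fun m _ => ?_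
  rw [inner_tridiag_single hL0 hA hLR y.1 m _ (hw m), lp.inner_single_right, hy m]

/-! ### Off-diagonal part contractive relative to the diagonal. -/

/-- The formal operator is symmetric between the maximal domain and the domain of the diagonal. -/
theorem inner_add_apply_eq (hL0 : L 0 = 0) (hA : ∀ n x y, ⟪A n x, y⟫_ℂ = ⟪x, A n y⟫_ℂ)
    (hLR : ∀ n x y, ⟪L (n + 1) x, y⟫_ℂ = ⟪x, R n y⟫_ℂ)
    {M : lp (fun _ : ℕ => E) 2 →L[ℂ] lp (fun _ : ℕ => E) 2}
    (hM : ∀ v d : lp (fun _ : ℕ => E) 2, (∀ n, d n = A n (v n)) →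
      ∀ n, M d n = L n (v (n - 1)) + R n (v (n + 1)))
    {u w v d : lp (fun _ : ℕ => E) 2} (hw : ∀ n, w n = tridiag A L R u n)
    (hd : ∀ n, d n = A n (v n)) : ⟪u, d + M d⟫_ℂ = ⟪w, v⟫_ℂ := by
  -- Expanding `d`, rather than truncating the pairing, avoids boundary terms: continuity of `M`
  -- gives convergence, and each one-entry term is a finite summation by parts.
  have h1 := (lp.hasSum_single (p := 2) (by simp) d).mapL
    ((innerSL ℂ u).comp (ContinuousLinearMap.id ℂ (lp (fun _ : ℕ => E) 2) + M))
  refine h1.unique ((lp.hasSum_inner w v).congr_fun fun n => ?_)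
  rw [hw n, ← inner_tridiag_single hL0 hA hLR u n (v n)
    (w := lp.single 2 n (d n) + M (lp.single 2 n (d n)))]
  · rfl
  intro k
  have hs : ∀ k, (lp.single 2 n (d n) : lp (fun _ : ℕ => E) 2) k =
      A k ((lp.single 2 n (v n) : lp (fun _ : ℕ => E) 2) k) := by
    intro k
    by_cases hk : k = n
    · subst hk
      simp [hd]
    · rw [lp.single_apply_ne (E := fun _ : ℕ => E) 2 n _ hk,
        lp.single_apply_ne (E := fun _ : ℕ => E) 2 n _ hk, map_zero]
  rw [lp.coeFn_add, Pi.add_apply, hM _ _ hs k, hs k, tridiag]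
  abel

/-- The cross term is the real part of `z` times the real number `⟪T x, x⟫`, hence zero. Both `(T +
z)⁻¹` and `T (T + z)⁻¹` are therefore contractions. -/
theorem norm_apply_add_smul_sq {T : E →L[ℂ] E} (hT : ∀ x y, ⟪T x, y⟫_ℂ = ⟪x, T y⟫_ℂ) {z : ℂ}
    (hz : z.re = 0) (hz1 : ‖z‖ = 1) (x : E) : ‖T x + z • x‖ ^ 2 = ‖T x‖ ^ 2 + ‖x‖ ^ 2 := by
  have him : (⟪T x, x⟫_ℂ).im = 0 := by
    rw [← Complex.conj_eq_iff_im, inner_conj_symm, hT]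
  have h := norm_add_sq (𝕜 := ℂ) (T x) (z • x)
  rw [inner_smul_right, norm_smul, hz1, one_mul] at h
  simpa [hz, him] using h

/-- A solution `u` of the eigenvalue equation at an imaginary unit vanishes if the off-diagonal part
is a contraction relative to the diagonal. -/
theorem eq_zero_of_tridiag_eq_smul [FiniteDimensional ℂ E]
    (hL0 : L 0 = 0) (hA : ∀ n x y, ⟪A n x, y⟫_ℂ = ⟪x, A n y⟫_ℂ)
    (hLR : ∀ n x y, ⟪L (n + 1) x, y⟫_ℂ = ⟪x, R n y⟫_ℂ)
    {M : lp (fun _ : ℕ => E) 2 →L[ℂ] lp (fun _ : ℕ => E) 2}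
    (hM : ∀ v d : lp (fun _ : ℕ => E) 2, (∀ n, d n = A n (v n)) →
      ∀ n, M d n = L n (v (n - 1)) + R n (v (n + 1))) (hM1 : ‖M‖ ≤ 1)
    {z : ℂ} (hz : z.re = 0) (hz1 : ‖z‖ = 1)
    {u : lp (fun _ : ℕ => E) 2} (hu : ∀ n, tridiag A L R u n = z • u n) : u = 0 := by
  have hsq := fun n => norm_apply_add_smul_sq (hA n) hz hz1
  have hsurj : ∀ n, ∃ x, A n x + z • x = u n := by
    intro n
    refine LinearMap.injective_iff_surjective (f := (A n : E →ₗ[ℂ] E) + z • LinearMap.id).1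
      ((injective_iff_map_eq_zero _).2 fun x hx => ?_) (u n)
    have h := hsq n x
    have hx' : A n x + z • x = 0 := hx
    rw [hx', norm_zero] at h
    have : ‖x‖ ^ 2 = 0 := by nlinarith [sq_nonneg ‖A n x‖, sq_nonneg ‖x‖]
    simpa using this
  choose x hx using hsurj
  obtain ⟨g, hg, -⟩ := lp_norm_sq_le (f := x) (norm_nonneg u) fun K =>
    (Finset.sum_le_sum fun n _ => by
      rw [← hx n, hsq]
      exact le_add_of_nonneg_left (sq_nonneg _)).trans (lp_sum_norm_sq_le u (Finset.range K))
  obtain ⟨d, hd, hdn⟩ := lp_norm_sq_le (f := fun n => A n (x n)) (norm_nonneg u) fun K =>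
    (Finset.sum_le_sum fun n _ => by
      rw [← hx n, hsq]
      exact le_add_of_nonneg_right (sq_nonneg _)).trans (lp_sum_norm_sq_le u (Finset.range K))
  have hdg : ∀ n, d n = A n (g n) := fun n => by rw [hd, hg]
  have hu' : d + z • g = u := lp.ext (funext fun n => by
    rw [lp.coeFn_add, Pi.add_apply, lp.coeFn_smul, Pi.smul_apply, hd, hg, hx])
  have hconj : (starRingEnd ℂ) z = -z := by
    apply Complex.ext <;> simp [hz]
  have h1 := inner_add_apply_eq hL0 hA hLR hM (u := u) (w := z • u) (v := g) (d := d)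
    (fun n => (hu n).symm) hdg
  have h2 : ⟪u, u + M d⟫_ℂ = 0 := by
    have : u + M d = (d + M d) + z • g := by rw [← hu']; abel
    rw [this, inner_add_right, h1, inner_smul_left, inner_smul_right, hconj]
    ring
  have hMd : ‖M d‖ ≤ ‖u‖ := (M.le_opNorm d).trans
    ((mul_le_mul hM1 hdn (norm_nonneg _) zero_le_one).trans_eq (one_mul _))
  -- Since `⟪u, M d⟫ = -‖u‖²`, expanding the square gives `‖u + M d‖² = ‖M d‖² - ‖u‖² ≤ 0`.
  have h3 : u + M d = 0 := by
    have h := norm_add_sq (𝕜 := ℂ) u (M d)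
    have h4 : RCLike.re ⟪u, M d⟫_ℂ = -‖u‖ ^ 2 := by
      rw [inner_add_right, inner_self_eq_norm_sq_to_K] at h2
      rw [eq_neg_of_add_eq_zero_right h2]
      simp [← Complex.ofReal_pow]
    rw [h4] at h
    have h5 : ‖M d‖ ^ 2 ≤ ‖u‖ ^ 2 := pow_le_pow_left₀ (norm_nonneg _) hMd 2
    have h6 : ‖u + M d‖ ^ 2 = 0 := le_antisymm (by linarith) (sq_nonneg _)
    simpa using h6
  have h7 : d + M d = -(z • g) := by
    rw [eq_neg_iff_add_eq_zero, ← h3, ← hu']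
    abel
  -- Now `g` solves the equation at `-z` and lies in the domain of the diagonal, so symmetry can be
  -- applied to `g` against itself.
  have h8 := inner_add_apply_eq hL0 hA hLR hM (u := g) (w := d + M d) (v := g) (d := d)
    (fun n => by
      rw [lp.coeFn_add, Pi.add_apply, hM _ _ hdg, hdg, tridiag]
      abel) hdg
  rw [h7, inner_neg_left, inner_neg_right, inner_smul_left, inner_smul_right, hconj] at h8
  have hz0 : z ≠ 0 := by
    rintro rfl
    simp at hz1
  have hg0 : g = 0 := by
    have : z * ⟪g, g⟫_ℂ = 0 := by linear_combination -h8 / 2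
    simpa [hz0] using this
  have hd0 : d = 0 := lp.ext (funext fun n => by rw [hdg, hg0]; simp)
  rw [← hu', hd0, hg0]
  simp

/-- If the off-diagonal part is a contraction relative to the diagonal, then the finite sequences
form a core of the maximal operator. -/
theorem maximalGraph_le_closure [FiniteDimensional ℂ E]
    (hL0 : L 0 = 0) (hA : ∀ n x y, ⟪A n x, y⟫_ℂ = ⟪x, A n y⟫_ℂ)
    (hLR : ∀ n x y, ⟪L (n + 1) x, y⟫_ℂ = ⟪x, R n y⟫_ℂ)
    {M : lp (fun _ : ℕ => E) 2 →L[ℂ] lp (fun _ : ℕ => E) 2}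
    (hM : ∀ v d : lp (fun _ : ℕ => E) 2, (∀ n, d n = A n (v n)) →
      ∀ n, M d n = L n (v (n - 1)) + R n (v (n + 1))) (hM1 : ‖M‖ ≤ 1) :
    maximalGraph A L R ≤ (finiteGraph A L R).topologicalClosure := by
  -- The product carries the sup norm; the `WithLp 2` copy supplies the inner product needed to
  -- project onto the closed graph.
  let e := WithLp.prodContinuousLinearEquiv 2 ℂ (lp (fun _ : ℕ => E) 2) (lp (fun _ : ℕ => E) 2)
  let K : Submodule ℂ (WithLp 2 (lp (fun _ : ℕ => E) 2 × lp (fun _ : ℕ => E) 2)) :=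
    (finiteGraph A L R).topologicalClosure.comap (e : WithLp 2 (lp (fun _ : ℕ => E) 2 × lp (fun _ : ℕ => E) 2) →ₗ[ℂ]
      lp (fun _ : ℕ => E) 2 × lp (fun _ : ℕ => E) 2)
  have hKc : IsClosed (K : Set (WithLp 2 (lp (fun _ : ℕ => E) 2 × lp (fun _ : ℕ => E) 2))) :=
    (Submodule.isClosed_topologicalClosure _).preimage e.continuous
  have : CompleteSpace K := hKc.completeSpace_coe
  have hcl : (finiteGraph A L R).topologicalClosure ≤ maximalGraph A L R :=
    Submodule.topologicalClosure_minimal _ finiteGraph_le_maximalGraph isClosed_maximalGraph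
  intro q hq
  obtain ⟨y, hy, r, hr, hqr⟩ := Submodule.exists_add_mem_mem_orthogonal (K := K) (e.symm q)
  have hq' : q = e y + e r := by rw [← map_add, ← hqr, e.apply_symm_apply]
  have hrm : e r ∈ maximalGraph A L R := by
    rw [eq_sub_of_add_eq' hq'.symm]
    exact Submodule.sub_mem _ hq (hcl hy)
  obtain ⟨⟨f, g⟩, hfg⟩ : ∃ x : lp (fun _ : ℕ => E) 2 × lp (fun _ : ℕ => E) 2, e r = x := ⟨_, rfl⟩
  rw [hfg] at hrm
  have hfg' : ∀ n, g n = tridiag A L R f n := hrm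
  -- Orthogonality of `(f, g)` to the one-entry elements of the graph says `T g = -f`, besides `T f
  -- = g`.
  have hgf : ∀ n, tridiag A L R g n = -f n := by
    intro n
    refine ext_inner_right ℂ fun x => ?_
    obtain ⟨w, hw⟩ := exists_tridiag_single (A := A) (R := R) hL0 n x
    have hmem : e.symm (lp.single 2 n x, w) ∈ K :=
      Submodule.le_topologicalClosure _ (single_mem_finiteGraph n x hw)
    have h := Submodule.inner_left_of_mem_orthogonal hmem hr
    rw [WithLp.prod_inner_apply] at h
    have h1 : r.ofLp = (f, g) := hfg
    have h2 : (e.symm (lp.single 2 n x, w)).ofLp = (lp.single 2 n x, w) := rfl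
    rw [h1, h2, lp.inner_single_right, inner_tridiag_single hL0 hA hLR g n x hw] at h
    rw [inner_neg_left]
    exact eq_neg_of_add_eq_zero_right h
  -- With `z² = -1`, `T (g + z f) = -f + z g = z (g + z f)`. Using both `i` and `-i` separates `f`
  -- from `g`.
  have key : ∀ z : ℂ, z.re = 0 → ‖z‖ = 1 → z * z = -1 → g + z • f = 0 := by
    intro z hz hz1 hzz
    refine eq_zero_of_tridiag_eq_smul hL0 hA hLR hM hM1 hz hz1 fun n => ?_
    have h : tridiag A L R (g + z • f : lp (fun _ : ℕ => E) 2) n = tridiag A L R g n + z • tridiag A L R f n := by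
      simp only [tridiag, lp.coeFn_add, Pi.add_apply, lp.coeFn_smul, Pi.smul_apply, map_add,
        map_smul, smul_add]
      abel
    rw [h, hgf, ← hfg', lp.coeFn_add, Pi.add_apply, lp.coeFn_smul, Pi.smul_apply, smul_add,
      smul_smul, hzz, neg_one_smul, add_comm]
  have h1 := key Complex.I (by simp) (by simp) (by simp)
  have h2 := key (-Complex.I) (by simp) (by simp) (by simp)
  have hf : f = 0 := by
    have : (2 * Complex.I) • f = 0 := by
      rw [← sub_eq_zero.2 (h1.trans h2.symm)]
      module
    simpa using this
  have hg : g = 0 := by simpa [hf] using h1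
  rw [hq', hfg, hf, hg]
  rw [← Prod.zero_eq_mk, add_zero]
  exact hy

/-- A bounded off-diagonal perturbation does not change the cores of the maximal operator. -/
theorem maximalGraph_le_closure_of_bounded {L' R' : ℕ → E →L[ℂ] E}
    {F : lp (fun _ : ℕ => E) 2 →L[ℂ] lp (fun _ : ℕ => E) 2}
    (hF : ∀ (f : lp (fun _ : ℕ => E) 2) n, tridiag A L' R' f n = tridiag A L R f n + F f n)
    (h : maximalGraph A L R ≤ (finiteGraph A L R).topologicalClosure) :
    maximalGraph A L' R' ≤ (finiteGraph A L' R').topologicalClosure := by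
  rintro ⟨f, g⟩ hfg
  -- This shear carries one finite graph into the other, and by continuity also their closures.
  have hc : Continuous fun x : lp (fun _ : ℕ => E) 2 × lp (fun _ : ℕ => E) 2 =>
      (x.1, x.2 + F x.1) := by fun_prop
  have hm : (f, g - F f) ∈ maximalGraph A L R := fun n => by
    have := hfg n
    simp only [hF] at this
    simp [this]
  have h1 : (f, g - F f) ∈ closure (finiteGraph A L R : Set (lp (fun _ : ℕ => E) 2 ×
    lp (fun _ : ℕ => E) 2)) := h hm
  have h2 := map_mem_closure hc h1 (t := (finiteGraph A L' R' : Set (lp (fun _ : ℕ => E) 2 ×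
    lp (fun _ : ℕ => E) 2))) fun x hx => ⟨hx.1, fun n => by simp [hF, hx.2 n]⟩
  rw [sub_add_cancel] at h2
  exact h2

/-- If the off-diagonal part is a strict contraction relative to the diagonal, then the domain of
the closure is contained in the domain of the diagonal. -/
theorem exists_apply_eq_of_mem_closure
    {M : lp (fun _ : ℕ => E) 2 →L[ℂ] lp (fun _ : ℕ => E) 2}
    (hM : ∀ v d : lp (fun _ : ℕ => E) 2, (∀ n, d n = A n (v n)) →
      ∀ n, M d n = L n (v (n - 1)) + R n (v (n + 1))) (hM1 : ‖M‖ < 1)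
    {x : lp (fun _ : ℕ => E) 2 × lp (fun _ : ℕ => E) 2}
    (hx : x ∈ (finiteGraph A L R).topologicalClosure) :
    Memℓp (fun n => A n (x.1 n)) 2 := by
  obtain ⟨y, hy, hyx⟩ := mem_closure_iff_seq_limit.1 hx
  have hd : ∀ k, Memℓp (fun n => A n ((y k).1 n)) 2 := fun k => by
    refine (memℓp_zero ((hy k).1.subset fun n hn h => hn ?_)).of_exponent_ge zero_le
    simp [h]
  let d : ℕ → lp (fun _ : ℕ => E) 2 := fun k => ⟨_, hd k⟩
  have h1 : ∀ k, d k = (y k).2 - M (d k) := fun k => by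
    rw [eq_sub_iff_add_eq]
    refine lp.ext (funext fun n => ?_)
    rw [(hy k).2 n, lp.coeFn_add, Pi.add_apply, hM _ _ fun n => rfl, tridiag]
    simp only [d]
    abel
  obtain ⟨C, hC⟩ := (Metric.isBounded_range_of_tendsto _
    ((continuous_snd.tendsto _).comp hyx)).exists_norm_le
  have h2 : ∀ k, ‖d k‖ ≤ C / (1 - ‖M‖) := fun k => by
    rw [le_div_iff₀ (by linarith)]
    have h3 : ‖d k‖ ≤ C + ‖M‖ * ‖d k‖ := by
      conv_lhs => rw [h1]
      exact (norm_sub_le _ _).trans (add_le_add (hC _ ⟨k, rfl⟩) (M.le_opNorm _))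
    linarith
  -- Fatou: the `d k` are bounded in `l²` and converge entrywise.
  refine lp.memℓp_of_tendsto (F := d) (l := atTop)
    (isBounded_iff_forall_norm_le.2 ⟨_, Set.forall_mem_range.2 h2⟩) (tendsto_pi_nhds.2 fun n => ?_)
  exact ((A n).continuous.tendsto _).comp
    (((continuous_lp_apply n).comp continuous_fst).tendsto _ |>.comp hyx)

/-! ### Selfadjointness from equality of the minimal and maximal graphs. -/

/-- A densely defined operator that is both the closure of the operator on the finite sequences and
the maximal operator is selfadjoint. -/
theorem isSelfAdjoint_of_graph_eq [CompleteSpace E] (hL0 : L 0 = 0)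
    (hA : ∀ n x y, ⟪A n x, y⟫_ℂ = ⟪x, A n y⟫_ℂ)
    (hLR : ∀ n x y, ⟪L (n + 1) x, y⟫_ℂ = ⟪x, R n y⟫_ℂ)
    {T : lp (fun _ : ℕ => E) 2 →ₗ.[ℂ] lp (fun _ : ℕ => E) 2}
    (hdense : Dense (T.domain : Set (lp (fun _ : ℕ => E) 2)))
    (hmin : T.graph = (finiteGraph A L R).topologicalClosure)
    (hmax : T.graph = maximalGraph A L R) : IsSelfAdjoint T := by
  refine LinearPMap.isSelfAdjoint_def.2 (le_antisymm (LinearPMap.le_of_le_graph ?_)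
    (LinearPMap.le_of_le_graph ?_)) <;>
    rw [LinearPMap.adjoint_graph_eq_graph_adjoint hdense] <;> rintro ⟨f, g⟩ hfg
  -- Testing an element of the adjoint graph against one-entry sequences recovers the formal product
  -- row by row.
  · rw [hmax]
    intro m
    refine ext_inner_left ℂ fun x => ?_
    obtain ⟨w, hw⟩ := exists_tridiag_single (A := A) (R := R) hL0 m x
    have hmem : (lp.single 2 m x, w) ∈ T.graph := by
      rw [hmin]
      exact Submodule.le_topologicalClosure _ (single_mem_finiteGraph m x hw)
    have h1 := (Submodule.mem_adjoint_iff _ _).1 hfg (lp.single 2 m x) w hmem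
    have h2 := inner_tridiag_single hL0 hA hLR f m x hw
    rw [lp.inner_single_left, sub_eq_zero] at h1
    rw [← h1, ← inner_conj_symm, h2, inner_conj_symm]
  · rw [Submodule.mem_adjoint_iff]
    rw [hmax] at hfg
    intro a b hab
    rw [hmin] at hab
    have hc : IsClosed {x : lp (fun _ : ℕ => E) 2 × lp (fun _ : ℕ => E) 2 |
        ⟪f, x.2⟫_ℂ = ⟪g, x.1⟫_ℂ} :=
      isClosed_eq (by fun_prop) (by fun_prop)
    have h1 : ⟪f, b⟫_ℂ = ⟪g, a⟫_ℂ := closure_minimal (fun x hx =>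
      inner_eq_of_mem_finiteGraph hL0 hA hLR hx hfg) hc hab
    rw [sub_eq_zero, ← inner_conj_symm, h1, inner_conj_symm]

end Core

end Tridiagonal

/-! ### Blocks of the Jacobi matrix: relative bound of the tail, boundedness of the head. -/

namespace BlockJacobi

variable {p : ℕ} (J : BlockJacobi p)

theorem norm_matOp_conjTranspose (X : Matrix (Fin p) (Fin p) ℂ) :
    ‖matOp X.conjTranspose‖ = ‖matOp X‖ := by
  rw [← Matrix.star_eq_conjTranspose, matOp, map_star, ContinuousLinearMap.star_eq_adjoint,
    LinearIsometryEquiv.norm_map]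

theorem inner_matOp_conjTranspose (X : Matrix (Fin p) (Fin p) ℂ) (x y : EuclideanSpace ℂ (Fin p)) :
    ⟪matOp X.conjTranspose x, y⟫_ℂ = ⟪x, matOp X y⟫_ℂ := by
  rw [← Matrix.star_eq_conjTranspose, matOp, map_star, ContinuousLinearMap.star_eq_adjoint,
    ContinuousLinearMap.adjoint_inner_left]

theorem matOp_mul_apply (X Y : Matrix (Fin p) (Fin p) ℂ) (x : EuclideanSpace ℂ (Fin p)) :
    matOp (X * Y) x = matOp X (matOp Y x) := by
  rw [matOp, map_mul]
  rfl

/-- A null vector of one block, placed at position `n`, is a null vector of the whole diagonal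
operator. -/
theorem isUnit_A (hker : LinearMap.ker J.diagOp.toFun = ⊥) (n : ℕ) : IsUnit (J.A n) := by
  rw [Matrix.isUnit_iff_isUnit_det, isUnit_iff_ne_zero]
  intro hdet
  obtain ⟨v, hv, hv0⟩ := Matrix.exists_mulVec_eq_zero_iff.2 hdet
  let x : EuclideanSpace ℂ (Fin p) := WithLp.toLp 2 v
  have hx : matOp (J.A n) x = 0 := by
    ext i
    simpa [x] using congrFun hv0 i
  have h0 : (fun k => matOp (J.A k) ((lp.single 2 n x : BlockSeq p) k)) = 0 := by
    funext k
    by_cases hk : k = n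
    · subst hk
      simpa using hx
    · rw [lp.single_apply_ne (E := fun _ : ℕ => EuclideanSpace ℂ (Fin p)) 2 n x hk, map_zero]
      rfl
  have hmem : (lp.single 2 n x : BlockSeq p) ∈ J.diagOp.domain := by
    change Memℓp (fun k => matOp (J.A k) ((lp.single 2 n x : BlockSeq p) k)) 2
    rw [h0]
    exact zero_memℓp
  have hk : (⟨_, hmem⟩ : J.diagOp.domain) ∈ LinearMap.ker J.diagOp.toFun :=
    LinearMap.mem_ker.2 (lp.ext h0)
  rw [hker, Submodule.mem_bot] at hk
  have : x = 0 := by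
    have h := congrArg (fun f : J.diagOp.domain => (f : BlockSeq p) n) hk
    simpa using h
  exact hv (by simpa [x] using this)

theorem norm_add_norm_le_a₁ {N n : ℕ} (h₁ : J.a₁ N < ⊤) (hn : N ≤ n) :
    ‖matOp ((J.A n)⁻¹ * J.B n)‖ + ‖matOp ((J.A n)⁻¹ * J.lower n)‖ ≤ (J.a₁ N).toReal := by
  rw [← ENNReal.ofReal_le_iff_le_toReal h₁.ne, ENNReal.ofReal_add (norm_nonneg _) (norm_nonneg _)]
  exact le_iSup₂_of_le n hn le_rfl

theorem norm_add_norm_le_a₂ {N n : ℕ} (h₂ : J.a₂ N < ⊤) (hn : N ≤ n) :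
    ‖matOp ((J.A n)⁻¹ * J.B n)‖ + ‖matOp ((J.A (n + 2))⁻¹ * (J.B (n + 1)).conjTranspose)‖ ≤
      (J.a₂ N).toReal := by
  rw [← ENNReal.ofReal_le_iff_le_toReal h₂.ne, ENNReal.ofReal_add (norm_nonneg _) (norm_nonneg _)]
  exact le_iSup₂_of_le n hn le_rfl

/-- The lower diagonal of blocks that is adjoint to an upper diagonal of blocks. -/
def adjointLower (β : ℕ → Matrix (Fin p) (Fin p) ℂ) : ℕ → Matrix (Fin p) (Fin p) ℂ
  | 0 => 0
  | n + 1 => (β n).conjTranspose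

/-- The upper diagonal blocks with index larger than `N`. -/
def tailB (N n : ℕ) : Matrix (Fin p) (Fin p) ℂ := if N < n then J.B n else 0

/-- The upper diagonal blocks with index at most `N`. -/
def headB (N n : ℕ) : Matrix (Fin p) (Fin p) ℂ := if N < n then 0 else J.B n

/-- The off-diagonal blocks beyond `N`, relative to the diagonal. -/
theorem exists_relative_clm (hA : ∀ n, IsUnit (J.A n)) {N : ℕ} (h₁ : J.a₁ N < ⊤)
    (h₂ : J.a₂ N < ⊤) :
    ∃ M : BlockSeq p →L[ℂ] BlockSeq p, (∀ v d : BlockSeq p, (∀ n, d n = matOp (J.A n) (v n)) →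
      ∀ n, M d n = matOp (adjointLower (J.tailB N) n) (v (n - 1)) +
        matOp (J.tailB N n) (v (n + 1))) ∧ ‖M‖ ≤ √((J.a₂ N).toReal * (J.a₁ N).toReal) := by
  have hinv : ∀ n (X : Matrix (Fin p) (Fin p) ℂ) (x : EuclideanSpace ℂ (Fin p)),
      matOp (X * (J.A n)⁻¹) (matOp (J.A n) x) = matOp X x := fun n X x => by
    rw [← matOp_mul_apply, Matrix.mul_assoc,
      Matrix.nonsing_inv_mul _ ((Matrix.isUnit_iff_isUnit_det _).1 (hA n)), Matrix.mul_one]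
  -- Taking adjoints turns `X Aₙ⁻¹` into `Aₙ⁻¹ X*`; this is why `a₂` bounds rows and `a₁` bounds
  -- columns.
  have hnorm : ∀ n (X : Matrix (Fin p) (Fin p) ℂ),
      ‖matOp (X * (J.A n)⁻¹)‖ = ‖matOp ((J.A n)⁻¹ * X.conjTranspose)‖ := fun n X => by
    rw [← norm_matOp_conjTranspose, Matrix.conjTranspose_mul, (J.isHermitian_A n).inv.eq]
  let L : ℕ → EuclideanSpace ℂ (Fin p) →L[ℂ] EuclideanSpace ℂ (Fin p) := fun n =>
    matOp (adjointLower (J.tailB N) n * (J.A (n - 1))⁻¹)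
  let R : ℕ → EuclideanSpace ℂ (Fin p) →L[ℂ] EuclideanSpace ℂ (Fin p) := fun n =>
    matOp (J.tailB N n * (J.A (n + 1))⁻¹)
  have hL : ∀ n, ‖L (n + 1)‖ = ‖matOp ((J.A n)⁻¹ * J.tailB N n)‖ := fun n => by
    simp only [L, hnorm, adjointLower, Matrix.conjTranspose_conjTranspose, Nat.add_sub_cancel]
  have hR : ∀ n, ‖R n‖ = ‖matOp ((J.A (n + 1))⁻¹ * (J.tailB N n).conjTranspose)‖ := fun n => by
    simp only [R, hnorm]
  have hL0 : L 0 = 0 := by simp [L, adjointLower]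
  have hR0 : R 0 = 0 := by simp [R, tailB]
  have hL1 : L 1 = 0 := by simp [L, adjointLower, tailB]
  have hzero : ∀ n ≤ N, J.tailB N n = 0 := fun n hn => if_neg hn.not_gt
  have hle : ∀ n, ‖matOp ((J.A n)⁻¹ * J.tailB N n)‖ ≤ ‖matOp ((J.A n)⁻¹ * J.B n)‖ := fun n => by
    unfold tailB
    split_ifs <;> simp
  have hle' : ∀ n, ‖matOp ((J.A (n + 1))⁻¹ * (J.tailB N n).conjTranspose)‖ ≤
      ‖matOp ((J.A (n + 1))⁻¹ * (J.B n).conjTranspose)‖ := fun n => by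
    unfold tailB
    split_ifs <;> simp
  -- The strict cutoff `N < n` in `tailB` matters: keeping `B N` would put `‖A_{N+1}⁻¹ B_N*‖` into
  -- row `N`, a term that does not occur in `a₂ N`.
  have hrow : ∀ n, ‖L n‖ + ‖R n‖ ≤ (J.a₂ N).toReal := by
    rintro (_ | n)
    · simp [hL0, hR0]
    · rw [hL, hR]
      rcases lt_or_ge n N with hn | hn
      · simp [hzero n hn.le, hzero (n + 1) hn]
      · exact (add_le_add (hle n) (hle' (n + 1))).trans (J.norm_add_norm_le_a₂ h₂ hn)
  have hcol : ∀ n, ‖R n‖ + ‖L (n + 2)‖ ≤ (J.a₁ N).toReal := by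
    intro n
    rw [hL, hR, add_comm]
    rcases lt_or_ge (n + 1) N with hn | hn
    · simp [hzero n (by omega), hzero (n + 1) hn.le]
    · exact (add_le_add (hle (n + 1)) (hle' n)).trans (J.norm_add_norm_le_a₁ h₁ hn)
  obtain ⟨M, hM, hMn⟩ := exists_tridiag_clm hL0 hrow (by simp [hL1]) hcol
  refine ⟨M, fun v d hd n => ?_, hMn⟩
  rw [hM, hd, hd]
  simp only [L, R, hinv]

/-- Finitely many off-diagonal blocks define a bounded operator. -/
theorem exists_head_clm (N : ℕ) : ∃ F : BlockSeq p →L[ℂ] BlockSeq p, ∀ f n,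
    F f n = matOp (adjointLower (J.headB N) n) (f (n - 1)) + matOp (J.headB N n) (f (n + 1)) := by
  let C : ℝ := ∑ n ∈ Finset.range (N + 1), ‖matOp (J.B n)‖
  have hC0 : 0 ≤ C := Finset.sum_nonneg fun _ _ => norm_nonneg _
  have hR : ∀ n, ‖matOp (J.headB N n)‖ ≤ C := fun n => by
    unfold headB
    split_ifs with h
    · simpa using hC0
    · exact Finset.single_le_sum (f := fun n => ‖matOp (J.B n)‖) (fun _ _ => norm_nonneg _)
        (Finset.mem_range.2 (by omega))
  have hL : ∀ n, ‖matOp (adjointLower (J.headB N) n)‖ ≤ C := by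
    rintro (_ | n)
    · simpa [adjointLower] using hC0
    · exact (norm_matOp_conjTranspose _).trans_le (hR n)
  obtain ⟨F, hF, -⟩ := exists_tridiag_clm (L := fun n => matOp (adjointLower (J.headB N) n))
    (R := fun n => matOp (J.headB N n)) (a := C + C) (b := C + C) (by simp [adjointLower])
    (fun n => add_le_add (hL n) (hR n)) ((hL 1).trans (by linarith))
    (fun n => add_le_add (hR n) (hL _))
  exact ⟨F, hF⟩

/-! ### Graphs, closability and domains of the Jacobi operator. -/

/-- The graph of the minimal operator before closure. -/
noncomputable abbrev minGraph : Submodule ℂ (BlockSeq p × BlockSeq p) :=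
  finiteGraph (fun n => matOp (J.A n)) (fun n => matOp (J.lower n)) (fun n => matOp (J.B n))

/-- The graph of the maximal operator. -/
noncomputable abbrev maxGraph : Submodule ℂ (BlockSeq p × BlockSeq p) :=
  maximalGraph (fun n => matOp (J.A n)) (fun n => matOp (J.lower n)) (fun n => matOp (J.B n))

theorem graph_preOp : J.preOp.graph = J.minGraph := by
  ext ⟨f, g⟩
  rw [LinearPMap.mem_graph_iff]
  constructor
  · rintro ⟨y, rfl, rfl⟩
    exact ⟨y.2, fun n => rfl⟩
  · rintro ⟨hf, hg⟩
    exact ⟨⟨f, hf⟩, rfl, lp.ext (funext fun n => (hg n).symm)⟩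

/-- The closure of the graph stays inside the closed maximal graph, whose second component is
determined by the first. -/
theorem preOp_isClosable : J.preOp.IsClosable := by
  refine ⟨J.preOp.graph.topologicalClosure.toLinearPMap, ?_⟩
  rw [Submodule.toLinearPMap_graph_eq]
  intro x hx hx0
  rw [graph_preOp] at hx
  have h := Submodule.topologicalClosure_minimal _ finiteGraph_le_maximalGraph
    isClosed_maximalGraph hx
  refine lp.ext (funext fun n => (h n).trans ?_)
  simp [hx0, tridiag]

theorem graph_op : J.op.graph = J.minGraph.topologicalClosure := by
  rw [op, ← J.preOp_isClosable.graph_closure_eq_closure_graph, graph_preOp]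

theorem dense_finiteSeq : Dense (finiteSeq p : Set (BlockSeq p)) := by
  intro f
  refine mem_closure_of_tendsto (lp.hasSum_single (p := 2) (by simp) f)
    (Filter.Eventually.of_forall fun s => ?_)
  refine Submodule.sum_mem _ fun i _ => (Set.finite_singleton i).subset fun n hn => ?_
  by_contra h
  exact hn (lp.single_apply_ne (E := fun _ : ℕ => EuclideanSpace ℂ (Fin p)) 2 i _ h)

theorem inner_matOp_A (n : ℕ) (x y : EuclideanSpace ℂ (Fin p)) :
    ⟪matOp (J.A n) x, y⟫_ℂ = ⟪x, matOp (J.A n) y⟫_ℂ := by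
  conv_lhs => rw [← (J.isHermitian_A n).eq]
  exact inner_matOp_conjTranspose _ _ _

/-- If the finite sequences form a core of the maximal operator, then the Jacobi operator is
selfadjoint. -/
theorem isSelfAdjoint_op (h : J.maxGraph ≤ J.minGraph.topologicalClosure) :
    IsSelfAdjoint J.op := by
  have hmax : J.op.graph = J.maxGraph := by
    rw [graph_op]
    exact le_antisymm (Submodule.topologicalClosure_minimal _ finiteGraph_le_maximalGraph
      isClosed_maximalGraph) h
  exact isSelfAdjoint_of_graph_eq (A := fun n => matOp (J.A n)) (L := fun n => matOp (J.lower n))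
    (R := fun n => matOp (J.B n)) (by simp [lower]) J.inner_matOp_A
    (fun n x y => inner_matOp_conjTranspose (J.B n) x y)
    (dense_finiteSeq.mono J.preOp.le_closure.1) J.graph_op hmax

/-- The relative bound yields a core of finite sequences and compares the domains. -/
theorem maxGraph_le_and_domain (hker : LinearMap.ker J.diagOp.toFun = ⊥)
    {N : ℕ} (h₁ : J.a₁ N < ⊤) (h₂ : J.a₂ N < ⊤) (h : J.a₁ N * J.a₂ N ≤ 1) :
    J.maxGraph ≤ J.minGraph.topologicalClosure ∧ J.diagOp.domain ≤ J.op.domain ∧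
      (J.a₁ N * J.a₂ N < 1 → J.op.domain ≤ J.diagOp.domain) := by
  obtain ⟨M, hM, hMn⟩ := J.exists_relative_clm (J.isUnit_A hker) h₁ h₂
  obtain ⟨F, hF⟩ := J.exists_head_clm N
  rw [← ENNReal.toReal_mul, mul_comm] at hMn
  have hM1 : ‖M‖ ≤ 1 := hMn.trans (Real.sqrt_le_one.2 (ENNReal.toReal_le_of_le_ofReal zero_le_one
    (by simpa using h)))
  have hT := maximalGraph_le_closure (A := fun n => matOp (J.A n))
    (L := fun n => matOp (adjointLower (J.tailB N) n)) (R := fun n => matOp (J.tailB N n))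
    (by simp [adjointLower]) J.inner_matOp_A
    (fun n x y => inner_matOp_conjTranspose (J.tailB N n) x y) hM hM1
  have hB : ∀ n, J.B n = J.tailB N n + J.headB N n := fun n => by
    unfold tailB headB
    split_ifs <;> simp
  have hlow : ∀ n, J.lower n = adjointLower (J.tailB N) n + adjointLower (J.headB N) n := by
    rintro (_ | n)
    · simp [lower, adjointLower]
    · simp only [lower, adjointLower, ← Matrix.conjTranspose_add, ← hB]
  have hadd : ∀ (f : BlockSeq p) n, tridiag (fun n => matOp (J.A n)) (fun n => matOp (J.lower n))
      (fun n => matOp (J.B n)) f n = tridiag (fun n => matOp (J.A n))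
        (fun n => matOp (adjointLower (J.tailB N) n)) (fun n => matOp (J.tailB N n)) f n +
        F f n := fun f n => by
    simp only [tridiag, hF, hlow, hB n, matOp, map_add, add_apply]
    abel
  have hmax := maximalGraph_le_closure_of_bounded hadd hT
  refine ⟨hmax, fun v hv => ?_, fun hlt f hf => ?_⟩
  · let d : BlockSeq p := ⟨fun n => matOp (J.A n) (v n), hv⟩
    -- On the domain of the diagonal the formal product is `(1 + M) A v + F v`, which is square
    -- summable.
    have hvm : (v, d + M d + F v) ∈ J.maxGraph := fun n => by
      rw [hadd, lp.coeFn_add, Pi.add_apply, lp.coeFn_add, Pi.add_apply, hM v d (fun _ => rfl),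
        tridiag]
      simp only [d]
      abel
    refine LinearPMap.mem_domain_of_mem_graph (y := d + M d + F v) ?_
    rw [graph_op]
    exact hmax hvm
  · have hg : (f, J.op ⟨f, hf⟩) ∈ J.op.graph := J.op.mem_graph ⟨f, hf⟩
    rw [graph_op] at hg
    have hg' : (f, J.op ⟨f, hf⟩) ∈ J.maxGraph := Submodule.topologicalClosure_minimal _
      finiteGraph_le_maximalGraph isClosed_maximalGraph hg
    have hM2 : ‖M‖ < 1 := hMn.trans_lt (by
      rw [Real.sqrt_lt' one_pos, one_pow, ← ENNReal.toReal_one]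
      exact (ENNReal.toReal_lt_toReal (hlt.trans ENNReal.one_lt_top).ne ENNReal.one_ne_top).2 hlt)
    -- Removing the bounded head leaves the tail operator, the one to which the strict contraction
    -- applies.
    have hmem : (f, J.op ⟨f, hf⟩ - F f) ∈ maximalGraph (fun n => matOp (J.A n))
        (fun n => matOp (adjointLower (J.tailB N) n)) (fun n => matOp (J.tailB N n)) := fun n => by
      have h3 := hg' n
      rw [hadd] at h3
      rw [lp.coeFn_sub, Pi.sub_apply, h3, add_sub_cancel_right]
    have h4 := exists_apply_eq_of_mem_closure (A := fun n => matOp (J.A n))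
      (L := fun n => matOp (adjointLower (J.tailB N) n)) (R := fun n => matOp (J.tailB N n))
      hM hM2 (hT hmem)
    exact h4

theorem finiteSeq_le_diagOp_domain : finiteSeq p ≤ J.diagOp.domain := by
  intro f hf
  have hf' : {n | f n ≠ 0}.Finite := hf
  refine (memℓp_zero (hf'.subset fun n hn h => hn ?_)).of_exponent_ge zero_le
  simp [h]

end BlockJacobi

theorem theorem2p2 (p : ℕ) (J : BlockJacobi p)
    (hker : LinearMap.ker J.diagOp.toFun = ⊥)
    (N : ℕ) (h₁ : J.a₁ N < ⊤) (h₂ : J.a₂ N < ⊤) :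
    (J.a₁ N * J.a₂ N ≤ 1 → EssentiallySelfAdjointOn J.op J.diagOp.domain) ∧
    (J.a₁ N * J.a₂ N < 1 → IsSelfAdjoint J.op ∧ J.op.domain = J.diagOp.domain) := by
  refine ⟨fun h => ?_, fun h => ?_⟩
  · obtain ⟨hcore, hdom, -⟩ := J.maxGraph_le_and_domain hker h₁ h₂ h
    have hclosed := J.preOp_isClosable.closure_isClosed
    have hle : J.op.domRestrict J.diagOp.domain ≤ J.op := LinearPMap.domRestrict_le
    have hres : (J.op.domRestrict J.diagOp.domain).IsClosable :=
      hclosed.isClosable.leIsClosable hle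
    -- The restriction lies between the operator on finite sequences and its closure `J.op`, so its
    -- own closure is `J.op`.
    have heq : (J.op.domRestrict J.diagOp.domain).closure = J.op := by
      refine le_antisymm ?_ ?_
      · refine (hclosed.isClosable.closure_mono hle).trans (LinearPMap.le_of_le_graph ?_)
        rw [← hclosed.isClosable.graph_closure_eq_closure_graph]
        exact Submodule.topologicalClosure_minimal _ le_rfl hclosed
      · refine hres.closure_mono ⟨fun f hf => ⟨J.finiteSeq_le_diagOp_domain hf,
          J.preOp.le_closure.1 hf⟩, fun x y hxy => ?_⟩
        have hy : (y : BlockSeq p) ∈ J.op.domain := y.2.2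
        rw [LinearPMap.domRestrict_apply (f := J.op) (y := ⟨y, hy⟩) rfl]
        exact J.preOp.le_closure.2 hxy
    exact ⟨hdom, hres, by rw [heq]; exact J.isSelfAdjoint_op hcore⟩
  · obtain ⟨hcore, hdom, hdom'⟩ := J.maxGraph_le_and_domain hker h₁ h₂ h.le
    exact ⟨J.isSelfAdjoint_op hcore, le_antisymm (hdom' h) hdom⟩
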